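/- Let $R$ be an associative ring with identity; all modules are unital $R$-modules on one fixed side. For modules $Q,N$: $Q$ is $N$-injective if every homomorphism from a submodule of $N$ to $Q$ extends to $N$; $Q$ is $N$-projective if every homomorphism from $Q$ to a factor module $N/K$ lifts to $N$ along $N\to N/K$; and $Q$ is almost $N$-injective if for every submodule $N'\subseteq N$ and every homomorphism $f:N'\to Q$, either $f$ extends to a homomorphism $N\to Q$, or there are a nonzero idempotent $\pi\in\operatorname{End}_R(N)$ and a homomorphism $h:Q\to\pi(N)$ with $hf=\pi|_{N'}$. For a module $M$, let $\sigma(M)$ be the full subcategory of the category of $R$-modules consisting of all modules subgenerated by $M$, i.e. isomorphic to a submodule of a factor module of a direct sum of copies of $M$, and let $J(M)$ be the Jacobson radical of $M$ (the intersection of all maximal submodules of $M$, equal to $M$ if there are none). A module $N$ is a $V$-module if every simple module is $N$-injective. A module $M$ is an almost $V$-module if every simple module is almost $N$-injective for every $N\in\sigma(M)$. A module is local if it has a largest proper submodule. **Theorem.** For every module $M$ the following are equivalent: 1. $M$ is an almost $V$-module. 2. Every module in $\sigma(M)$ is a $V$-module or has a nonzero direct summand that is a projective object of the category $\sigma(M)$.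 3. There is an independent family $\{A_i\}_{i\in I}$ (possibly empty) of local submodules of $M$ such that (a) every $A_i$ is $M$-injective, $M$-projective and of length two; (b) $J(M)=\bigoplus_{i\in I}J(A_i)$; (c) $M/J(M)$ is a $V$-module. -/

import Mathlib

universe u v w

/-! Modules are left modules over an arbitrary (not necessarily commutative) ring; right modules
over a ring are left modules over its opposite. -/

/-- `Q` is `N`-injective: every homomorphism from a submodule of `N` to `Q` extends to `N`. -/
def IsRelInjective (R : Type u) [Ring R] (Q : Type v) [AddCommGroup Q] [Module R Q]
    (N : Type w) [AddCommGroup N] [Module R N] : Prop :=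
  ∀ (N' : Submodule R N) (f : N' →ₗ[R] Q), ∃ g : N →ₗ[R] Q, g ∘ₗ N'.subtype = f

/-- `P` is `N`-projective: every homomorphism from `P` to a factor module of `N` lifts to `N`. -/
def IsRelProjective (R : Type u) [Ring R] (P : Type v) [AddCommGroup P] [Module R P]
    (N : Type w) [AddCommGroup N] [Module R N] : Prop :=
  ∀ (K : Submodule R N) (f : P →ₗ[R] N ⧸ K), ∃ h : P →ₗ[R] N, K.mkQ ∘ₗ h = f

/-- `Q` is almost `N`-injective: for every submodule `N'` of `N` and every `f : N' → Q`, either `f`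
extends to `N`, or there are a nonzero idempotent endomorphism `π` of `N` and a homomorphism
`h : Q → π(N)` such that `h ∘ f` is the restriction of `π` to `N'`. -/
def IsAlmostRelInjective (R : Type u) [Ring R] (Q : Type v) [AddCommGroup Q] [Module R Q]
    (N : Type w) [AddCommGroup N] [Module R N] : Prop :=
  ∀ (N' : Submodule R N) (f : N' →ₗ[R] Q),
    (∃ g : N →ₗ[R] Q, g ∘ₗ N'.subtype = f) ∨
    (∃ (π : Module.End R N) (h : Q →ₗ[R] LinearMap.range π),
      π ≠ 0 ∧ IsIdempotentElem π ∧ ∀ x : N', (h (f x) : N) = π x)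

/-- `N` belongs to `σ(M)`, i.e. `N` is subgenerated by `M`: it embeds into a factor module of a
direct sum of copies of `M`. -/
def IsSubgenerated (R : Type u) [Ring R] (M : Type v) [AddCommGroup M] [Module R M]
    (N : Type v) [AddCommGroup N] [Module R N] : Prop :=
  ∃ (Λ : Type v) (K : Submodule R (Λ →₀ M)) (j : N →ₗ[R] (Λ →₀ M) ⧸ K), Function.Injective j

/-- `P` is a projective object of `σ(M)`. (As `σ(M)` is closed under factor modules, its
epimorphisms are the surjective homomorphisms.) -/
def IsProjectiveInSigma (R : Type u) [Ring R] (M : Type v) [AddCommGroup M] [Module R M]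
    (P : Type v) [AddCommGroup P] [Module R P] : Prop :=
  IsSubgenerated R M P ∧
  ∀ (X Y : Type v) [AddCommGroup X] [Module R X] [AddCommGroup Y] [Module R Y],
    IsSubgenerated R M X → IsSubgenerated R M Y →
    ∀ (g : X →ₗ[R] Y) (f : P →ₗ[R] Y), Function.Surjective g → ∃ h : P →ₗ[R] X, g ∘ₗ h = f

/-- `N` is a `V`-module: every simple module is `N`-injective. -/
def IsVModule (R : Type u) [Ring R] (N : Type v) [AddCommGroup N] [Module R N] : Prop :=
  ∀ (S : Type v) [AddCommGroup S] [Module R S], IsSimpleModule R S → IsRelInjective R S N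

/-- `M` is an almost `V`-module: every simple module is almost `N`-injective for all `N ∈ σ(M)`. -/
def IsAlmostVModule (R : Type u) [Ring R] (M : Type v) [AddCommGroup M] [Module R M] : Prop :=
  ∀ (S : Type v) [AddCommGroup S] [Module R S], IsSimpleModule R S →
    ∀ (N : Type v) [AddCommGroup N] [Module R N], IsSubgenerated R M N →
      IsAlmostRelInjective R S N

/-- A local module: it has a largest proper submodule (in particular it is nonzero). -/
def IsLocalMod (R : Type u) [Ring R] (A : Type v) [AddCommGroup A] [Module R A] : Prop :=
  ∃ K : Submodule R A, K ≠ ⊤ ∧ ∀ L : Submodule R A, L ≠ ⊤ → L ≤ K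

/-- The Jacobson radical `J(A)` of a submodule `A` of `M`, regarded as a submodule of `M`. -/
def jacobsonOfSubmodule (R : Type u) [Ring R] (M : Type v) [AddCommGroup M] [Module R M]
    (A : Submodule R M) : Submodule R M :=
  (Module.jacobson R A).map A.subtype

/-! All three conditions are equivalent to one intermediate property, `MonolithicProjective`: every
nonsimple module of `σ(M)` with a monolith (least nonzero submodule) is projective in `σ(M)`. Two
facts are used throughout. In a monolithic module, disjoint submodules cannot both be nonzero, so it
is indecomposable. And whenever a map from a submodule to a simple module fails to extend, a
submodule maximal among those containing its kernel and avoiding a suitable element gives a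
nonsimple monolithic factor module (`exists_quotient_of_not_extends`). If such factors are
projective they split off, which gives both the idempotents of condition 1 and the summands of
condition 2. Conversely, condition 1 splits every epimorphism in `σ(M)` onto a nonsimple monolithic
module, and under condition 2 such a module, being indecomposable and not a `V`-module, is itself
projective.

For condition 3, the property forces every nonsimple monolithic module of `σ(M)` to be `M`-injective
of length two: an `M`-injective monolithic extension has a maximal monolith, by a local-endomorphism
argument, and the original module fills this extension. A maximal independent family of such
submodules of `M` then accounts for all of `J(M)`. Conversely, given the family, a monolithic factor
of a direct sum of copies of `M` either contains a copy of some `A_i`, which splits off and is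
everything, or is generated by images of the `V`-module `M/J(M)` and is therefore simple. -/

theorem LinearMap.exists_comp_eq_of_ker_le {R A B C : Type*} [Ring R] [AddCommGroup A]
    [Module R A] [AddCommGroup B] [Module R B] [AddCommGroup C] [Module R C] (p : A →ₗ[R] B)
    (hp : Function.Surjective p) (g : A →ₗ[R] C) (h : LinearMap.ker p ≤ LinearMap.ker g) :
    ∃ r : B →ₗ[R] C, ∀ x, r (p x) = g x :=
  ⟨(LinearMap.ker p).liftQ g h ∘ₗ (p.quotKerEquivOfSurjective hp).symm.toLinearMap, fun x => by
    have : (p.quotKerEquivOfSurjective hp).symm (p x) = (LinearMap.ker p).mkQ x := by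
      rw [LinearEquiv.symm_apply_eq]; rfl
    simp only [LinearMap.comp_apply, LinearEquiv.coe_coe, this]
    rfl⟩

/-! ### Closure properties of `σ(M)` -/

section Subgenerated

variable {R : Type u} [Ring R] {M : Type w} [AddCommGroup M] [Module R M]
  {N N' : Type w} [AddCommGroup N] [Module R N] [AddCommGroup N'] [Module R N']

theorem IsSubgenerated.of_surjective_of_injective {Λ Q : Type w} [AddCommGroup Q] [Module R Q]
    (g : (Λ →₀ M) →ₗ[R] Q) (hg : Function.Surjective g) (j : N →ₗ[R] Q)
    (hj : Function.Injective j) : IsSubgenerated R M N :=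
  ⟨Λ, LinearMap.ker g, (g.quotKerEquivOfSurjective hg).symm.toLinearMap ∘ₗ j,
    (g.quotKerEquivOfSurjective hg).symm.injective.comp hj⟩

theorem IsSubgenerated.of_injective (hN : IsSubgenerated R M N) (i : N' →ₗ[R] N)
    (hi : Function.Injective i) : IsSubgenerated R M N' := by
  obtain ⟨Λ, K, j, hj⟩ := hN
  exact ⟨Λ, K, j ∘ₗ i, hj.comp hi⟩

theorem IsSubgenerated.of_surjective (hN : IsSubgenerated R M N) (p : N →ₗ[R] N')
    (hp : Function.Surjective p) : IsSubgenerated R M N' := by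
  obtain ⟨Λ, K, j, hj⟩ := hN
  have hker : LinearMap.ker ((((LinearMap.ker p).map j).mkQ ∘ₗ j)) = LinearMap.ker p := by
    ext x
    simp [hj.eq_iff]
  refine .of_surjective_of_injective (((LinearMap.ker p).map j).mkQ ∘ₗ K.mkQ)
    ((Submodule.mkQ_surjective _).comp (Submodule.mkQ_surjective _))
    ((LinearMap.ker p).liftQ (((LinearMap.ker p).map j).mkQ ∘ₗ j) hker.ge ∘ₗ
      (p.quotKerEquivOfSurjective hp).symm.toLinearMap) ?_
  rw [LinearMap.coe_comp]
  refine Function.Injective.comp ?_ (p.quotKerEquivOfSurjective hp).symm.injective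
  rw [← LinearMap.ker_eq_bot, Submodule.ker_liftQ_eq_bot']
  exact hker.symm

variable (R M) in
theorem IsSubgenerated.refl : IsSubgenerated R M M :=
  .of_surjective_of_injective (Λ := PUnit) (Finsupp.lapply PUnit.unit)
    (fun x => ⟨Finsupp.single PUnit.unit x, by simp⟩) LinearMap.id Function.injective_id

theorem IsSubgenerated.dfinsupp {ι : Type w} (P : ι → Type w) [∀ i, AddCommGroup (P i)]
    [∀ i, Module R (P i)] (h : ∀ i, IsSubgenerated R M (P i)) :
    IsSubgenerated R M (Π₀ i, P i) := by
  classical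
  choose Λ K j hj using h
  refine .of_surjective_of_injective (Λ := Σ i, Λ i) (Q := Π₀ i, (Λ i →₀ M) ⧸ K i)
    (DFinsupp.mapRange.linearMap (fun i => (K i).mkQ) ∘ₗ
      (sigmaFinsuppLequivDFinsupp R).toLinearMap) ?_ (DFinsupp.mapRange.linearMap j) ?_
  · rw [LinearMap.coe_comp]
    refine Function.Surjective.comp ?_ (sigmaFinsuppLequivDFinsupp R).surjective
    exact (DFinsupp.mapRange_surjective _ fun i => map_zero _).2
      fun i => Submodule.mkQ_surjective _
  · exact (DFinsupp.mapRange_injective _ fun i => map_zero _).2 hj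

theorem IsSubgenerated.sSup (s : Set (Submodule R N)) (h : ∀ P ∈ s, IsSubgenerated R M P) :
    IsSubgenerated R M ↥(sSup s) := by
  classical
  rw [sSup_eq_iSup', Submodule.iSup_eq_range_dfinsupp_lsum]
  exact (IsSubgenerated.dfinsupp (fun P : s => (P : Submodule R N)) fun P => h P P.2).of_surjective
    (LinearMap.rangeRestrict _) (LinearMap.surjective_rangeRestrict _)

theorem IsSubgenerated.sup {P Q : Submodule R N} (hP : IsSubgenerated R M P)
    (hQ : IsSubgenerated R M Q) : IsSubgenerated R M ↥(P ⊔ Q) := by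
  rw [← sSup_pair]
  exact .sSup _ (by simp [hP, hQ])

theorem IsSubgenerated.range (hN : IsSubgenerated R M N) (f : N →ₗ[R] N') :
    IsSubgenerated R M (LinearMap.range f) :=
  hN.of_surjective f.rangeRestrict f.surjective_rangeRestrict

theorem IsSubgenerated.prod (hN : IsSubgenerated R M N) (hN' : IsSubgenerated R M N') :
    IsSubgenerated R M (N × N') := by
  have h := (hN.range (LinearMap.inl R N N')).sup (hN'.range (LinearMap.inr R N N'))
  rw [LinearMap.sup_range_inl_inr] at h
  exact h.of_surjective Submodule.topEquiv.toLinearMap Submodule.topEquiv.surjective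

end Subgenerated

/-! ### Relative injectivity passes from `M` to `σ(M)` -/

section RelInjective

variable {R : Type u} [Ring R] {Q : Type v} [AddCommGroup Q] [Module R Q]
  {M N N' : Type w} [AddCommGroup M] [Module R M] [AddCommGroup N] [Module R N]
  [AddCommGroup N'] [Module R N']

theorem IsRelInjective.exists_comp_eq (h : IsRelInjective R Q N) (i : N' →ₗ[R] N)
    (hi : Function.Injective i) (f : N' →ₗ[R] Q) : ∃ g : N →ₗ[R] Q, g ∘ₗ i = f := by
  obtain ⟨g, hg⟩ := h (LinearMap.range i) (f ∘ₗ (LinearEquiv.ofInjective i hi).symm.toLinearMap)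
  refine ⟨g, LinearMap.ext fun x => ?_⟩
  have := LinearMap.congr_fun hg (LinearEquiv.ofInjective i hi x)
  simpa using this

theorem IsRelInjective.of_injective (h : IsRelInjective R Q N) (i : N' →ₗ[R] N)
    (hi : Function.Injective i) : IsRelInjective R Q N' := fun L f => by
  obtain ⟨g, hg⟩ := h.exists_comp_eq (i ∘ₗ L.subtype) (hi.comp L.injective_subtype) f
  exact ⟨g ∘ₗ i, hg⟩

theorem IsRelInjective.of_surjective (h : IsRelInjective R Q N) (p : N →ₗ[R] N')
    (hp : Function.Surjective p) : IsRelInjective R Q N' := fun L f => by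
  obtain ⟨g, hg⟩ := h (L.comap p) (f ∘ₗ p.restrict (fun _ hx => hx))
  have hg' : ∀ x (hx : p x ∈ L), g x = f ⟨p x, hx⟩ := fun x hx =>
    LinearMap.congr_fun hg ⟨x, hx⟩
  have hker : LinearMap.ker p ≤ LinearMap.ker g := fun x hx => by
    have hx0 : p x = 0 := hx
    have : (⟨p x, by simp [hx0]⟩ : L) = 0 := Subtype.ext hx0
    rw [LinearMap.mem_ker, hg' x (by simp [hx0]), this, map_zero]
  obtain ⟨r, hr⟩ := p.exists_comp_eq_of_ker_le hp g hker
  refine ⟨r, LinearMap.ext fun ⟨y, hy⟩ => ?_⟩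
  obtain ⟨x, rfl⟩ := hp y
  exact (hr x).trans (hg' x hy)

theorem IsRelInjective.of_equiv {Q' : Type*} [AddCommGroup Q'] [Module R Q']
    (h : IsRelInjective R Q N) (e : Q ≃ₗ[R] Q') : IsRelInjective R Q' N := fun L f => by
  obtain ⟨g, hg⟩ := h L (e.symm.toLinearMap ∘ₗ f)
  refine ⟨e.toLinearMap ∘ₗ g, LinearMap.ext fun x => ?_⟩
  simpa using congrArg e (LinearMap.congr_fun hg x)

/-- By Zorn, take a maximal partial extension. On each `P ∈ s` it can be glued with an extension to
`P` of its restriction to the intersection, so its domain already contains `P`. -/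
theorem isRelInjective_of_sSup_eq_top (s : Set (Submodule R N)) (hs : sSup s = ⊤)
    (h : ∀ P ∈ s, IsRelInjective R Q P) : IsRelInjective R Q N := fun L f => by
  obtain ⟨g, hfg, hg⟩ := zorn_le_nonempty_Ici₀ (⟨L, f⟩ : N →ₗ.[R] Q)
    (fun c _ hc y hy => ⟨LinearPMap.sSup c hc.directedOn,
      fun z hz => LinearPMap.le_sSup hc.directedOn hz⟩) _ le_rfl
  have htop : g.domain = ⊤ := by
    rw [eq_top_iff, ← hs, sSup_le_iff]
    intro P hP
    obtain ⟨k, hk⟩ := h P hP (g.domain.comap P.subtype)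
      (g.toFun ∘ₗ P.subtype.restrict (fun _ hx => hx))
    have hcompat : ∀ (x : g.domain) (y : (⟨P, k⟩ : N →ₗ.[R] Q).domain), (x : N) = y →
        g x = (⟨P, k⟩ : N →ₗ.[R] Q) y := by
      rintro ⟨x, hx⟩ ⟨y, hy⟩ (rfl : x = y)
      exact (LinearMap.congr_fun hk ⟨⟨x, hy⟩, hx⟩).symm
    have hle : g.sup ⟨P, k⟩ hcompat ≤ g := hg (LinearPMap.left_le_sup _ _ hcompat)
    exact (LinearPMap.right_le_sup _ _ hcompat).1.trans hle.1
  refine ⟨g.toFun ∘ₗ LinearMap.codRestrict g.domain LinearMap.id (fun x => htop ▸ trivial),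
    LinearMap.ext fun x => ?_⟩
  exact (hfg.2 (y := ⟨x, hfg.1 x.2⟩) rfl).symm

theorem IsRelInjective.of_isSubgenerated (h : IsRelInjective R Q M)
    (hN : IsSubgenerated R M N) : IsRelInjective R Q N := by
  obtain ⟨Λ, K, j, hj⟩ := hN
  refine IsRelInjective.of_injective ?_ j hj
  refine IsRelInjective.of_surjective ?_ K.mkQ K.mkQ_surjective
  refine isRelInjective_of_sSup_eq_top
    (Set.range fun l : Λ => LinearMap.range (Finsupp.lsingle (R := R) (M := M) l)) ?_ ?_
  · exact Finsupp.iSup_lsingle_range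
  · rintro _ ⟨l, rfl⟩
    exact h.of_surjective _ (LinearMap.surjective_rangeRestrict _)

end RelInjective

/-! ### Relative projectivity passes from `M` to `σ(M)` for finitely generated modules -/

section RelProjective

variable {R : Type u} [Ring R] {P : Type v} [AddCommGroup P] [Module R P]
  {M N N' : Type w} [AddCommGroup M] [Module R M] [AddCommGroup N] [Module R N]
  [AddCommGroup N'] [Module R N']

theorem IsRelProjective.exists_comp_eq (h : IsRelProjective R P N) {Y : Type*} [AddCommGroup Y]
    [Module R Y] (g : N →ₗ[R] Y) (f : P →ₗ[R] Y)
    (hfg : LinearMap.range f ≤ LinearMap.range g) : ∃ k : P →ₗ[R] N, g ∘ₗ k = f := by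
  obtain ⟨k, hk⟩ := h (LinearMap.ker g) (g.quotKerEquivRange.symm.toLinearMap ∘ₗ
    f.codRestrict (LinearMap.range g) fun x => hfg ⟨x, rfl⟩)
  refine ⟨k, LinearMap.ext fun x => ?_⟩
  have := congrArg g.quotKerEquivRange (LinearMap.congr_fun hk x)
  simpa using congrArg Subtype.val this

theorem IsRelProjective.of_injective (h : IsRelProjective R P N) (i : N' →ₗ[R] N)
    (hi : Function.Injective i) : IsRelProjective R P N' := fun K f => by
  have hker : LinearMap.ker ((K.map i).mkQ ∘ₗ i) = K := by
    ext x
    simp [hi.eq_iff]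
  have hinj : Function.Injective (K.liftQ ((K.map i).mkQ ∘ₗ i) hker.ge) := by
    rw [← LinearMap.ker_eq_bot, Submodule.ker_liftQ_eq_bot']
    exact hker.symm
  obtain ⟨k, hk⟩ := h (K.map i) (K.liftQ ((K.map i).mkQ ∘ₗ i) hker.ge ∘ₗ f)
  -- Modulo `i(K)` the lift agrees with an element of `i(N')`, and `i(K) ⊆ i(N')`.
  have hk' : ∀ x, k x ∈ LinearMap.range i := fun x => by
    obtain ⟨y, hy⟩ := K.mkQ_surjective (f x)
    have h1 := LinearMap.congr_fun hk x
    simp only [LinearMap.comp_apply, ← hy] at h1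
    have h2 : (K.map i).mkQ (k x) = (K.map i).mkQ (i y) := h1
    rw [← sub_eq_zero, ← map_sub, Submodule.mkQ_apply, Submodule.Quotient.mk_eq_zero] at h2
    obtain ⟨z, -, hz⟩ := h2
    exact ⟨z + y, by rw [map_add, hz]; abel⟩
  refine ⟨(LinearEquiv.ofInjective i hi).symm.toLinearMap ∘ₗ
    k.codRestrict (LinearMap.range i) hk', LinearMap.ext fun x => hinj ?_⟩
  have h1 : i ((LinearEquiv.ofInjective i hi).symm ⟨k x, hk' x⟩) = k x :=
    congrArg Subtype.val ((LinearEquiv.ofInjective i hi).apply_symm_apply ⟨k x, hk' x⟩)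
  have h2 := LinearMap.congr_fun hk x
  simp only [LinearMap.comp_apply] at h2 ⊢
  rw [← h2]
  exact congrArg _ h1

theorem IsRelProjective.of_surjective (h : IsRelProjective R P N) (p : N →ₗ[R] N')
    (hp : Function.Surjective p) : IsRelProjective R P N' := fun K f => by
  obtain ⟨k, hk⟩ := h.exists_comp_eq (K.mkQ ∘ₗ p) f (by
    rw [LinearMap.range_comp, LinearMap.range_eq_top.2 hp, Submodule.map_top,
      Submodule.range_mkQ]
    exact le_top)
  exact ⟨p ∘ₗ k, hk⟩

theorem IsRelProjective.sup {A B : Submodule R N} (hA : IsRelProjective R P A)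
    (hB : IsRelProjective R P B) : IsRelProjective R P ↥(A ⊔ B) := by
  refine fun K f => ?_
  set i := Submodule.inclusion (le_sup_left : A ≤ A ⊔ B)
  set j := Submodule.inclusion (le_sup_right : B ≤ A ⊔ B)
  have hsum : ∀ x : ↥(A ⊔ B), ∃ a b, i a + j b = x := fun x => by
    obtain ⟨a, ha, b, hb, hab⟩ := Submodule.mem_sup.1 x.2
    exact ⟨⟨a, ha⟩, ⟨b, hb⟩, Subtype.ext hab⟩
  set A' := LinearMap.range (K.mkQ ∘ₗ i)
  -- Lift through `B` modulo the image of `A`; the remaining error lies in that image and lifts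
  -- through `A`.
  obtain ⟨b, hb⟩ := hB.exists_comp_eq (A'.mkQ ∘ₗ K.mkQ ∘ₗ j) (A'.mkQ ∘ₗ f) (by
    rintro _ ⟨x, rfl⟩
    obtain ⟨y, hy⟩ := K.mkQ_surjective (f x)
    obtain ⟨a, b, rfl⟩ := hsum y
    refine ⟨b, ?_⟩
    simp only [LinearMap.comp_apply, ← hy, map_add]
    have : A'.mkQ (K.mkQ (i a)) = 0 := by
      rw [Submodule.mkQ_apply, Submodule.Quotient.mk_eq_zero]
      exact ⟨a, rfl⟩
    rw [this, zero_add])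
  obtain ⟨a, ha⟩ := hA.exists_comp_eq (K.mkQ ∘ₗ i) (f - K.mkQ ∘ₗ j ∘ₗ b) (by
    rintro _ ⟨x, rfl⟩
    have := LinearMap.congr_fun hb x
    simp only [LinearMap.comp_apply] at this
    rw [eq_comm, ← sub_eq_zero, ← map_sub, Submodule.mkQ_apply,
      Submodule.Quotient.mk_eq_zero] at this
    exact this)
  refine ⟨i ∘ₗ a + j ∘ₗ b, ?_⟩
  rw [LinearMap.comp_add]
  exact (eq_sub_iff_add_eq.1 ha)

theorem isRelProjective_of_subsingleton [Subsingleton N] : IsRelProjective R P N := fun K f =>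
  ⟨0, LinearMap.ext fun x => by
    obtain ⟨y, hy⟩ := K.mkQ_surjective (f x)
    rw [← hy, Subsingleton.elim y 0]
    simp⟩

theorem IsRelProjective.finset_sup {ι : Type*} (A : ι → Submodule R N) (t : Finset ι)
    (h : ∀ i ∈ t, IsRelProjective R P (A i)) : IsRelProjective R P ↥(t.sup A) := by
  classical
  induction t using Finset.induction_on with
  | empty =>
    rw [Finset.sup_empty]
    exact isRelProjective_of_subsingleton
  | insert i t _ ih =>
    rw [Finset.sup_insert]
    exact (h i (by simp)).sup (ih fun j hj => h j (by simp [hj]))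

/-- The image of a finitely generated module lies in the image of a finite subsum. -/
theorem isRelProjective_of_iSup_eq_top [Module.Finite R P] {ι : Type w} (A : ι → Submodule R N)
    (hA : ⨆ i, A i = ⊤) (h : ∀ i, IsRelProjective R P (A i)) : IsRelProjective R P N :=
  fun K f => by
  have hfg : (LinearMap.range f).FG := Module.Finite.iff_fg.1 inferInstance
  obtain ⟨t, ht⟩ := (CompleteLattice.isCompactElement_iff_exists_le_iSup_of_le_iSup _).1
    ((Submodule.fg_iff_compact _).1 hfg) ι (fun i => (A i).map K.mkQ) (by
      rw [← Submodule.map_iSup, hA, Submodule.map_top, Submodule.range_mkQ]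
      exact le_top)
  obtain ⟨k, hk⟩ := (IsRelProjective.finset_sup A t fun i _ => h i).exists_comp_eq
    (K.mkQ ∘ₗ (t.sup A).subtype) f (by
      rw [LinearMap.range_comp, Submodule.range_subtype, Finset.sup_eq_iSup]
      simpa only [Submodule.map_iSup, Finset.sup_eq_iSup] using ht)
  exact ⟨(t.sup A).subtype ∘ₗ k, hk⟩

theorem IsRelProjective.of_isSubgenerated [Module.Finite R P] (h : IsRelProjective R P M)
    (hN : IsSubgenerated R M N) : IsRelProjective R P N := by
  obtain ⟨Λ, K, j, hj⟩ := hN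
  refine IsRelProjective.of_injective ?_ j hj
  refine IsRelProjective.of_surjective ?_ K.mkQ K.mkQ_surjective
  exact isRelProjective_of_iSup_eq_top
    (fun l : Λ => LinearMap.range (Finsupp.lsingle (R := R) (M := M) l))
    (Finsupp.iSup_lsingle_range)
    fun l => h.of_surjective _ (LinearMap.surjective_rangeRestrict _)

end RelProjective

/-! ### Projective objects of `σ(M)` -/

section ProjectiveInSigma

variable {R : Type u} [Ring R] {M P P' X : Type w} [AddCommGroup M] [Module R M]
  [AddCommGroup P] [Module R P] [AddCommGroup P'] [Module R P'] [AddCommGroup X] [Module R X]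

theorem IsProjectiveInSigma.of_isRelProjective [Module.Finite R P] (hP : IsSubgenerated R M P)
    (h : IsRelProjective R P M) : IsProjectiveInSigma R M P :=
  ⟨hP, fun _ _ _ _ _ _ hX _ g f hg => (h.of_isSubgenerated hX).exists_comp_eq g f
    (by rw [LinearMap.range_eq_top.2 hg]; exact le_top)⟩

theorem IsProjectiveInSigma.isRelProjective (h : IsProjectiveInSigma R M P) :
    IsRelProjective R P M := fun K f =>
  h.2 _ _ (.refl R M) ((IsSubgenerated.refl R M).of_surjective K.mkQ K.mkQ_surjective) K.mkQ f
    K.mkQ_surjective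

theorem IsProjectiveInSigma.of_equiv (h : IsProjectiveInSigma R M P) (e : P ≃ₗ[R] P') :
    IsProjectiveInSigma R M P' :=
  ⟨h.1.of_surjective e.toLinearMap e.surjective, fun X Y _ _ _ _ hX hY g f hg => by
    obtain ⟨k, hk⟩ := h.2 X Y hX hY g (f ∘ₗ e.toLinearMap) hg
    refine ⟨k ∘ₗ e.symm.toLinearMap, LinearMap.ext fun x => ?_⟩
    simpa using LinearMap.congr_fun hk (e.symm x)⟩

theorem IsProjectiveInSigma.exists_section (h : IsProjectiveInSigma R M P)
    (hX : IsSubgenerated R M X) (p : X →ₗ[R] P) (hp : Function.Surjective p) :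
    ∃ s : P →ₗ[R] X, p ∘ₗ s = LinearMap.id :=
  h.2 X P hX h.1 p LinearMap.id hp

theorem isProjectiveInSigma_of_forall_exists_section (hP : IsSubgenerated R M P)
    (h : ∀ (X : Type w) [AddCommGroup X] [Module R X], IsSubgenerated R M X →
      ∀ p : X →ₗ[R] P, Function.Surjective p → ∃ s : P →ₗ[R] X, p ∘ₗ s = LinearMap.id) :
    IsProjectiveInSigma R M P :=
  ⟨hP, fun X Y _ _ _ _ hX _ g f hg => by
    -- The pullback of `g` and `f`, which stays in `σ(M)`; a section of its projection to `P` is a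
    -- lift of `f`.
    set Z : Submodule R (X × P) := LinearMap.eqLocus (g ∘ₗ LinearMap.fst R X P)
      (f ∘ₗ LinearMap.snd R X P)
    obtain ⟨s, hs⟩ := h Z ((hX.prod hP).of_injective Z.subtype Z.injective_subtype)
      (LinearMap.snd R X P ∘ₗ Z.subtype) (fun y => by
        obtain ⟨x, hx⟩ := hg (f y)
        exact ⟨⟨(x, y), hx⟩, rfl⟩)
    refine ⟨LinearMap.fst R X P ∘ₗ Z.subtype ∘ₗ s, LinearMap.ext fun y => ?_⟩
    have h1 : g (s y : X × P).1 = f (s y : X × P).2 := (s y).2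
    have h2 : (s y : X × P).2 = y := LinearMap.congr_fun hs y
    simp only [LinearMap.comp_apply, Submodule.subtype_apply, LinearMap.fst_apply, h1, h2]⟩

end ProjectiveInSigma

/-! ### Modules with a monolith -/

section Monolith

variable {R : Type u} [Ring R] {N : Type w} [AddCommGroup N] [Module R N]

/-- A monolith of a module: a least nonzero submodule. -/
def IsMonolith (S : Submodule R N) : Prop :=
  S ≠ ⊥ ∧ ∀ L : Submodule R N, L ≠ ⊥ → S ≤ L

variable {S : Submodule R N}

theorem IsMonolith.isAtom (h : IsMonolith S) : IsAtom S :=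
  ⟨h.1, fun L hL => by_contra fun hL' => hL.not_ge (h.2 L hL')⟩

theorem IsMonolith.isSimpleModule (h : IsMonolith S) : IsSimpleModule R S :=
  isSimpleModule_iff_isAtom.2 h.isAtom

theorem IsMonolith.eq_bot_or_eq_bot (h : IsMonolith S) {A B : Submodule R N}
    (hAB : Disjoint A B) : A = ⊥ ∨ B = ⊥ := by
  by_contra! hne
  exact h.1 (le_bot_iff.1 (hAB (h.2 A hne.1) (h.2 B hne.2)))

theorem IsMonolith.le_ker_of_not_injective (h : IsMonolith S) {X : Type*} [AddCommGroup X]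
    [Module R X] {f : N →ₗ[R] X} (hf : ¬ Function.Injective f) : S ≤ LinearMap.ker f :=
  h.2 _ fun hker => hf (LinearMap.ker_eq_bot.1 hker)

theorem IsMonolith.not_range_le_of_isAtom (h : IsMonolith S) (hS : S ≠ ⊤) {X : Type*}
    [AddCommGroup X] [Module R X] {f : N →ₗ[R] X} (hf : Function.Injective f)
    {T : Submodule R X} (hT : IsAtom T) : ¬ LinearMap.range f ≤ T := fun hle => by
  have hlt : S.map f < (⊤ : Submodule R N).map f :=
    (Submodule.map_strictMono_of_injective hf) hS.lt_top
  rw [Submodule.map_top] at hlt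
  have := hT.2 _ (hlt.trans_le hle)
  exact h.1 (Submodule.map_injective_of_injective hf (this.trans (Submodule.map_bot f).symm))

theorem IsMonolith.map_equiv (h : IsMonolith S) {X : Type*} [AddCommGroup X] [Module R X]
    (e : N ≃ₗ[R] X) : IsMonolith (S.map e.toLinearMap) := by
  refine ⟨fun h0 => h.1 ?_, fun L hL => ?_⟩
  · exact Submodule.map_injective_of_injective (f := e.toLinearMap) e.injective
      (h0.trans (Submodule.map_bot _).symm)
  · rw [Submodule.map_le_iff_le_comap]
    refine h.2 _ fun h0 => hL ?_
    rw [← Submodule.map_comap_eq_of_surjective e.surjective L]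
    exact (congrArg (Submodule.map e.toLinearMap) h0).trans (Submodule.map_bot _)

theorem isMonolith_span_singleton {x : N} (hx : x ≠ 0)
    (h : ∀ y : N, y ≠ 0 → x ∈ Submodule.span R {y}) : IsMonolith (Submodule.span R {x}) := by
  refine ⟨by simpa using hx, fun L hL => ?_⟩
  obtain ⟨y, hy, hy0⟩ := Submodule.exists_mem_ne_zero_of_ne_bot hL
  rw [Submodule.span_singleton_le_iff_mem]
  exact (Submodule.span_singleton_le_iff_mem y L).2 hy (h y hy0)

theorem IsMonolith.mem_span_singleton (h : IsMonolith S) {x y : N} (hx : x ∈ S) (hy : y ≠ 0) :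
    x ∈ Submodule.span R {y} :=
  h.2 _ (by simpa using hy) hx

/-- The monolith is simple, so its identity extends to a retraction, which is injective because it
is injective on the monolith. -/
theorem IsMonolith.eq_top_of_isVModule (h : IsMonolith S) (hN : IsVModule R N) : S = ⊤ := by
  obtain ⟨r, hr⟩ := hN S h.isSimpleModule S LinearMap.id
  have hrS : ∀ x : S, r x = x := fun x => LinearMap.congr_fun hr x
  have hinj : Function.Injective r := by
    by_contra hni
    obtain ⟨x, hx, hx0⟩ := Submodule.exists_mem_ne_zero_of_ne_bot h.1
    have h1 := h.le_ker_of_not_injective hni hx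
    exact hx0 (by simpa using (hrS ⟨x, hx⟩).symm.trans h1)
  refine eq_top_iff.2 fun x _ => ?_
  rw [hinj (hrS (r x)).symm]
  exact (r x).2

/-- A submodule maximal among those that contain `K` and avoid `x` has a quotient in which the
class of `x` generates the monolith. -/
theorem exists_quotient_isMonolith (K : Submodule R N) {x : N} (hx : x ∉ K) :
    ∃ C : Submodule R N, K ≤ C ∧ x ∉ C ∧ IsMonolith (Submodule.span R {C.mkQ x}) := by
  obtain ⟨C, hKC, hC⟩ := zorn_le_nonempty₀ {C : Submodule R N | x ∉ C}
    (fun c hc hchain D hD => ⟨sSup c, by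
      rw [Set.mem_ofPred_eq, Submodule.mem_sSup_of_directed ⟨D, hD⟩ hchain.directedOn]
      rintro ⟨E, hE, hxE⟩
      exact hc hE hxE, fun z hz => le_sSup hz⟩) K hx
  refine ⟨C, hKC, hC.1, isMonolith_span_singleton (by simpa using hC.1) fun y hy => ?_⟩
  obtain ⟨y, rfl⟩ := C.mkQ_surjective y
  have hyC : y ∉ C := by simpa using hy
  have hlt : C < (Submodule.span R {C.mkQ y}).comap C.mkQ := by
    refine lt_of_le_of_ne (fun z hz => ?_) fun h => hyC ?_
    · have : C.mkQ z = 0 := by simpa using hz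
      simp [this]
    · rw [h]
      exact Submodule.mem_span_singleton_self _
  by_contra hmem
  exact hlt.not_ge (hC.2 (y := (Submodule.span R {C.mkQ y}).comap C.mkQ) hmem hlt.le)

/-- A homomorphism `f` from a submodule to a simple module that does not extend yields a quotient
with a proper monolith to which `f` transports. -/
theorem exists_quotient_of_not_extends {T : Type*} [AddCommGroup T] [Module R T]
    (hT : IsSimpleModule R T) (N' : Submodule R N) (f : N' →ₗ[R] T)
    (hf : ¬ ∃ g : N →ₗ[R] T, g ∘ₗ N'.subtype = f) :
    ∃ (C : Submodule R N) (S : Submodule R (N ⧸ C)) (h : T →ₗ[R] N ⧸ C),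
      IsMonolith S ∧ S ≠ ⊤ ∧ ∀ x : N', h (f x) = C.mkQ x := by
  have hf0 : f ≠ 0 := fun h0 => hf ⟨0, by simp [h0]⟩
  obtain ⟨x, hx⟩ : ∃ x, f x ≠ 0 := by
    by_contra! hall
    exact hf0 (LinearMap.ext hall)
  have hsurj : Function.Surjective f := LinearMap.surjective_of_ne_zero hf0
  obtain ⟨C, hKC, hxC, hS⟩ := exists_quotient_isMonolith
    ((LinearMap.ker f).map N'.subtype) (x := (x : N)) (by simpa using hx)
  have hker : LinearMap.ker f ≤ LinearMap.ker (C.mkQ ∘ₗ N'.subtype) := fun y hy => by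
    simpa using hKC ⟨y, hy, rfl⟩
  obtain ⟨h, hh⟩ := f.exists_comp_eq_of_ker_le hsurj _ hker
  replace hh : ∀ y : N', h (f y) = C.mkQ y := hh
  refine ⟨C, _, h, hS, fun htop => hf ?_, hh⟩
  have hh0 : h ≠ 0 := fun h0 => hxC (by simpa [h0] using (hh x).symm)
  have hinj : Function.Injective h := LinearMap.injective_of_ne_zero hh0
  -- If the monolith were the whole quotient, `h` would be an isomorphism and its inverse after
  -- `C.mkQ` would extend `f`.
  have hhsurj : Function.Surjective h := by
    rw [← LinearMap.range_eq_top, eq_top_iff, ← htop, Submodule.span_singleton_le_iff_mem]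
    exact ⟨f x, hh x⟩
  refine ⟨(LinearEquiv.ofBijective h ⟨hinj, hhsurj⟩).symm.toLinearMap ∘ₗ C.mkQ,
    LinearMap.ext fun y => ?_⟩
  simp only [LinearMap.comp_apply, LinearEquiv.coe_coe, Submodule.subtype_apply]
  rw [LinearEquiv.symm_apply_eq]
  exact (hh y).symm

theorem exists_quotient_of_not_isVModule (h : ¬ IsVModule R N) :
    ∃ (C : Submodule R N) (S : Submodule R (N ⧸ C)), IsMonolith S ∧ S ≠ ⊤ := by
  unfold IsVModule IsRelInjective at h
  push Not at h
  obtain ⟨T, _, _, hT, N', f, hf⟩ := h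
  obtain ⟨C, S, -, hS, hS', -⟩ := exists_quotient_of_not_extends hT N' f (by simpa using hf)
  exact ⟨C, S, hS, hS'⟩

end Monolith

/-! ### Conditions 1 and 2 through projectivity of monolithic modules -/

section Hub

variable {R : Type u} [Ring R] {M : Type w} [AddCommGroup M] [Module R M]

variable (R M) in
/-- Every nonsimple module of `σ(M)` with a monolith is projective in `σ(M)`. -/
def MonolithicProjective : Prop :=
  ∀ (N : Type w) [AddCommGroup N] [Module R N], IsSubgenerated R M N →
    ∀ S : Submodule R N, IsMonolith S → S ≠ ⊤ → IsProjectiveInSigma R M N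

variable {N : Type w} [AddCommGroup N] [Module R N]

theorem IsAlmostVModule.monolithicProjective (h : IsAlmostVModule R M) :
    MonolithicProjective R M := by
  intro N _ _ hN S hS hS'
  refine isProjectiveInSigma_of_forall_exists_section hN fun X _ _ hX p hp => ?_
  obtain ⟨s₀, hs₀, hs₀'⟩ := Submodule.exists_mem_ne_zero_of_ne_bot hS.1
  -- Almost injectivity is tested on the map from the preimage of `S` to `S` induced by `p`. An
  -- extension would vanish on `ker p` and make the proper submodule `S` a retract of `N`.
  rcases h S hS.isSimpleModule X hX (S.comap p) (p.restrict fun _ hx => hx) with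
    ⟨g, hg⟩ | ⟨π, k, hπ, hπ', hk⟩
  · exfalso
    have hg' : ∀ x (hx : p x ∈ S), (g x : N) = p x := fun x hx =>
      congrArg Subtype.val (LinearMap.congr_fun hg ⟨x, hx⟩)
    have hker : LinearMap.ker p ≤ LinearMap.ker g := fun x hx => by
      have hx0 : p x = 0 := hx
      exact Subtype.ext ((hg' x (by simp [hx0])).trans hx0)
    obtain ⟨r, hr⟩ := p.exists_comp_eq_of_ker_le hp g hker
    have hrS : ∀ y ∈ S, (r y : N) = y := fun y hy => by
      obtain ⟨x, rfl⟩ := hp y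
      rw [hr, hg' x hy]
    have hinj : Function.Injective r := by
      by_contra hni
      have h1 : r s₀ = 0 := hS.le_ker_of_not_injective hni hs₀
      exact hs₀' (by rw [← hrS s₀ hs₀, h1]; rfl)
    refine hS' (eq_top_iff.2 fun x _ => ?_)
    have : r (r x : N) = r x := Subtype.ext (hrS _ (r x).2)
    rw [← hinj this]
    exact (r x).2
  -- The idempotent kills `ker p`, so `π = q ∘ p` with `q ∘ p ∘ q = q`. As `N` is monolithic, either
  -- `q` is injective and is a section of `p`, or `p ∘ q = 0` and `π = 0`.
  · have hker : LinearMap.ker p ≤ LinearMap.ker π := fun x hx => by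
      have hx0 : p x = 0 := hx
      have h1 := hk ⟨x, by simp [hx0]⟩
      have h2 : (p.restrict (fun _ hx => hx) : S.comap p →ₗ[R] S) ⟨x, by simp [hx0]⟩ = 0 :=
        Subtype.ext hx0
      rw [h2, map_zero] at h1
      exact h1.symm
    obtain ⟨q, hq⟩ := p.exists_comp_eq_of_ker_le hp π hker
    have hqpq : ∀ y, q (p (q y)) = q y := fun y => by
      obtain ⟨x, rfl⟩ := hp y
      rw [hq, hq]
      exact LinearMap.congr_fun hπ' x
    have hdis : Disjoint (LinearMap.ker q) (LinearMap.range (p ∘ₗ q)) := by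
      rw [Submodule.disjoint_def]
      rintro _ h1 ⟨y, rfl⟩
      have h2 : q (p (q y)) = 0 := h1
      rw [hqpq] at h2
      simp [h2]
    rcases hS.eq_bot_or_eq_bot hdis with h1 | h1
    · exact ⟨q, LinearMap.ext fun y => LinearMap.ker_eq_bot.1 h1 (hqpq y)⟩
    · exfalso
      apply hπ
      ext x
      have h2 : p (q (p x)) = 0 := by
        have : p (q (p x)) ∈ LinearMap.range (p ∘ₗ q) := ⟨p x, rfl⟩
        rw [h1] at this
        exact this
      rw [LinearMap.zero_apply, ← hq, ← hqpq, h2, map_zero]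

theorem MonolithicProjective.exists_section (h : MonolithicProjective R M)
    (hN : IsSubgenerated R M N) {X : Type w} [AddCommGroup X] [Module R X] (p : N →ₗ[R] X)
    (hp : Function.Surjective p) {S : Submodule R X} (hS : IsMonolith S) (hS' : S ≠ ⊤) :
    ∃ s : X →ₗ[R] N, p ∘ₗ s = LinearMap.id :=
  (h X (hN.of_surjective p hp) S hS hS').exists_section hN p hp

theorem MonolithicProjective.isAlmostVModule (h : MonolithicProjective R M) :
    IsAlmostVModule R M := by
  intro T _ _ hT N _ _ hN N' f
  refine or_iff_not_imp_left.2 fun hf => ?_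
  obtain ⟨C, S, k, hS, hS', hk⟩ := exists_quotient_of_not_extends hT N' f hf
  obtain ⟨s, hs⟩ := h.exists_section hN C.mkQ C.mkQ_surjective hS hS'
  have hs' : ∀ y, C.mkQ (s y) = y := fun y => LinearMap.congr_fun hs y
  refine ⟨s ∘ₗ C.mkQ, (s ∘ₗ k).codRestrict _ fun t =>
      ⟨s (k t), by simp [-Submodule.mkQ_apply, hs']⟩,
    fun h0 => hS.1 ?_, LinearMap.ext fun x => ?_, fun x => ?_⟩
  · refine (Submodule.eq_bot_iff _).2 fun y _ => ?_
    have := LinearMap.congr_fun h0 (s y)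
    simp only [LinearMap.comp_apply, hs', LinearMap.zero_apply] at this
    rw [← hs' y, this, map_zero]
  · change s (C.mkQ (s (C.mkQ x))) = s (C.mkQ x)
    rw [hs']
  · change s (k (f x)) = s (C.mkQ x)
    rw [hk]

theorem MonolithicProjective.exists_projective_summand (h : MonolithicProjective R M)
    (hN : IsSubgenerated R M N) (hV : ¬ IsVModule R N) :
    ∃ D C : Submodule R N, IsCompl D C ∧ D ≠ ⊥ ∧ IsProjectiveInSigma R M D := by
  obtain ⟨C, S, hS, hS'⟩ := exists_quotient_of_not_isVModule hV
  obtain ⟨s, hs⟩ := h.exists_section hN C.mkQ C.mkQ_surjective hS hS'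
  have hs' : ∀ y, C.mkQ (s y) = y := fun y => LinearMap.congr_fun hs y
  have hinj : Function.Injective s := Function.LeftInverse.injective hs'
  refine ⟨LinearMap.range s, C, ?_, fun h0 => hS.1 ?_, ?_⟩
  · refine ⟨Submodule.disjoint_def.2 ?_, codisjoint_iff.2 (eq_top_iff.2 fun x _ => ?_)⟩
    · rintro _ ⟨y, rfl⟩ hy
      have : C.mkQ (s y) = 0 := by simpa using hy
      rw [hs'] at this
      simp [this]
    · refine Submodule.mem_sup.2 ⟨s (C.mkQ x), ⟨_, rfl⟩, x - s (C.mkQ x), ?_, by abel⟩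
      rw [← Submodule.Quotient.mk_eq_zero, ← Submodule.mkQ_apply, map_sub, hs', sub_self]
  · have : s = 0 := LinearMap.range_eq_bot.1 h0
    refine (Submodule.eq_bot_iff _).2 fun y _ => ?_
    rw [← hs' y, this]
    simp
  · exact (h _ (hN.of_surjective C.mkQ C.mkQ_surjective) S hS hS').of_equiv
      (LinearEquiv.ofInjective s hinj)

theorem monolithicProjective_of_exists_projective_summand
    (h : ∀ (N : Type w) [AddCommGroup N] [Module R N], IsSubgenerated R M N →
      IsVModule R N ∨ ∃ D C : Submodule R N, IsCompl D C ∧ D ≠ ⊥ ∧ IsProjectiveInSigma R M D) :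
    MonolithicProjective R M := by
  intro N _ _ hN S hS hS'
  obtain hV | ⟨D, C, hDC, hD, hP⟩ := h N hN
  · exact absurd (hS.eq_top_of_isVModule hV) hS'
  · have hC : C = ⊥ := (hS.eq_bot_or_eq_bot hDC.disjoint).resolve_left hD
    have hD' : D = ⊤ := by simpa [hC] using hDC.sup_eq_top
    subst hD'
    exact hP.of_equiv Submodule.topEquiv

end Hub

/-! ### Length two and locality of monolithic modules -/

section Structure

variable {R : Type u} [Ring R] {M N : Type w} [AddCommGroup M] [Module R M]
  [AddCommGroup N] [Module R N] {S : Submodule R N}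

theorem IsMonolith.isSimpleModule_of_eq_top (h : IsMonolith S) (hS : S = ⊤) :
    IsSimpleModule R N := by
  subst hS
  have := h.isSimpleModule
  exact IsSimpleModule.congr Submodule.topEquiv.symm

theorem IsMonolith.jacobson_eq (h : IsMonolith S) (hS : IsCoatom S) :
    Module.jacobson R N = S := by
  refine le_antisymm (sInf_le hS) (le_sInf fun L (hL : IsCoatom L) => h.2 L ?_)
  rintro rfl
  exact hS.1 (hL.2 S (bot_lt_iff_ne_bot.2 h.1))

theorem IsMonolith.length_eq_two (h : IsMonolith S) (hS : IsCoatom S) :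
    Module.length R N = 2 := by
  have := h.isSimpleModule
  have := isSimpleModule_iff_isCoatom.2 hS
  rw [Module.length_eq_add_of_exact S.subtype S.mkQ S.injective_subtype S.mkQ_surjective
    (LinearMap.exact_subtype_mkQ S), Module.length_eq_one, Module.length_eq_one]
  norm_num

theorem IsMonolith.isLocalMod (h : IsMonolith S) (hS : IsCoatom S) : IsLocalMod R N :=
  ⟨S, hS.1, fun L hL => by
    by_cases hL0 : L = ⊥
    · simp [hL0]
    · exact ((hS.le_iff.1 (h.2 L hL0)).resolve_left hL).le⟩

theorem IsLocalMod.exists_isAtom_isCoatom (h : IsLocalMod R N) (hN : Module.length R N = 2) :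
    ∃ K : Submodule R N, IsAtom K ∧ IsCoatom K ∧ ∀ L : Submodule R N, L ≠ ⊤ → L ≤ K := by
  obtain ⟨K, hK, hmax⟩ := h
  have hco : IsCoatom K := ⟨hK, fun L hL => by_contra fun hL' => hL.not_ge (hmax L hL')⟩
  have := isSimpleModule_iff_isCoatom.2 hco
  rw [Module.length_eq_add_of_exact K.subtype K.mkQ K.injective_subtype K.mkQ_surjective
    (LinearMap.exact_subtype_mkQ K), Module.length_eq_one R (N ⧸ K)] at hN
  have h1 : Module.length R K = 1 :=
    WithTop.add_right_cancel (z := 1) WithTop.one_ne_top (hN.trans one_add_one_eq_two.symm)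
  exact ⟨K, isSimpleModule_iff_isAtom.1 (Module.length_eq_one_iff.1 h1), hco, hmax⟩

theorem IsMonolith.surjective_of_injective (h : IsMonolith S) (hN : IsRelInjective R N N)
    (e : N →ₗ[R] N) (he : Function.Injective e) : Function.Surjective e := by
  obtain ⟨g, hg⟩ := hN.exists_comp_eq e he LinearMap.id
  have hge : ∀ x, g (e x) = x := fun x => LinearMap.congr_fun hg x
  have hdis : Disjoint (LinearMap.ker g) (LinearMap.range e) := by
    rw [Submodule.disjoint_def]
    rintro _ h1 ⟨y, rfl⟩
    rw [LinearMap.mem_ker, hge] at h1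
    simp [h1]
  rcases h.eq_bot_or_eq_bot hdis with h0 | h0
  · exact fun x => ⟨g x, LinearMap.ker_eq_bot.1 h0 (hge (g x))⟩
  · refine absurd ((Submodule.eq_bot_iff S).2 fun x _ => ?_) h.1
    rw [← hge x, LinearMap.range_eq_bot.1 h0]
    simp

/-- Projectivity gives an endomorphism `e` with image in `A` and `1 - e` with image in `B`. Their
kernels are disjoint, so one of them is injective, hence onto by self-injectivity. -/
theorem IsMonolith.eq_top_or_eq_top (h : IsMonolith S) (hN : IsRelInjective R N N)
    (hP : IsProjectiveInSigma R M N) {A B : Submodule R N} (hAB : A ⊔ B = ⊤) :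
    A = ⊤ ∨ B = ⊤ := by
  obtain ⟨k, hk⟩ := hP.2 A (N ⧸ B) (hP.1.of_injective A.subtype A.injective_subtype)
    (hP.1.of_surjective B.mkQ B.mkQ_surjective) (B.mkQ ∘ₗ A.subtype) B.mkQ (by
      rw [← LinearMap.range_eq_top, LinearMap.range_comp, Submodule.range_subtype,
        ← B.range_mkQ, LinearMap.range_eq_map, ← hAB, Submodule.map_sup]
      refine (sup_eq_left.2 ?_).symm
      rw [Submodule.map_le_iff_le_comap, Submodule.comap_map_mkQ]
      exact le_sup_left)
  have hkB : ∀ x, x - (k x : N) ∈ B := fun x => by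
    have := LinearMap.congr_fun hk x
    rw [← Submodule.Quotient.mk_eq_zero, ← Submodule.mkQ_apply, map_sub, sub_eq_zero]
    exact this.symm
  set e : N →ₗ[R] N := A.subtype ∘ₗ k
  have hdis : Disjoint (LinearMap.ker e) (LinearMap.ker (LinearMap.id - e)) := by
    rw [Submodule.disjoint_def]
    intro x h1 h2
    rw [LinearMap.mem_ker] at h1
    rwa [LinearMap.mem_ker, LinearMap.sub_apply, h1, sub_zero] at h2
  refine (h.eq_bot_or_eq_bot hdis).imp (fun h0 => ?_) fun h0 => ?_
  · refine eq_top_iff.2 fun x _ => ?_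
    obtain ⟨y, rfl⟩ := h.surjective_of_injective hN e (LinearMap.ker_eq_bot.1 h0) x
    exact (k y).2
  · refine eq_top_iff.2 fun x _ => ?_
    obtain ⟨y, rfl⟩ := h.surjective_of_injective hN _ (LinearMap.ker_eq_bot.1 h0) x
    exact hkB y

/-- Otherwise a nonsimple monolithic factor of `N ⧸ L` would split off from `N`, with a kernel
containing `L ≠ ⊥`, although `N` is indecomposable. -/
theorem MonolithicProjective.isVModule_quotient (h : MonolithicProjective R M)
    (hN : IsSubgenerated R M N) (hS : IsMonolith S) {L : Submodule R N} (hL : L ≠ ⊥) :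
    IsVModule R (N ⧸ L) := by
  by_contra hV
  obtain ⟨C, T, hT, hT'⟩ := exists_quotient_of_not_isVModule hV
  have hp : Function.Surjective (C.mkQ ∘ₗ L.mkQ) := by
    rw [LinearMap.coe_comp]
    exact C.mkQ_surjective.comp L.mkQ_surjective
  obtain ⟨s, hs⟩ := h.exists_section hN _ hp hT hT'
  have hs' : ∀ y, (C.mkQ ∘ₗ L.mkQ) (s y) = y := fun y => LinearMap.congr_fun hs y
  have hdis : Disjoint (LinearMap.ker (C.mkQ ∘ₗ L.mkQ)) (LinearMap.range s) := by
    rw [Submodule.disjoint_def]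
    rintro _ h1 ⟨y, rfl⟩
    rw [LinearMap.mem_ker, hs'] at h1
    simp [h1]
  rcases hS.eq_bot_or_eq_bot hdis with h0 | h0
  · refine hL (le_bot_iff.1 (h0 ▸ fun x hx => ?_))
    have : L.mkQ x = 0 := by simpa using hx
    rw [LinearMap.mem_ker, LinearMap.comp_apply, this, map_zero]
  · refine hT.1 ((Submodule.eq_bot_iff T).2 fun y _ => ?_)
    rw [← hs' y, LinearMap.range_eq_bot.1 h0]
    simp

/-- As `N ⧸ S` is a `V`-module, `S` is an intersection of maximal submodules. Two distinct ones
would sum to `N`, which `eq_top_or_eq_top` forbids. -/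
theorem MonolithicProjective.isCoatom_of_isRelInjective (h : MonolithicProjective R M)
    (hN : IsSubgenerated R M N) (hS : IsMonolith S) (hS' : S ≠ ⊤) (hinj : IsRelInjective R N M) :
    IsCoatom S := by
  have hco : ∀ y ∉ S, ∃ C : Submodule R N, IsCoatom C ∧ S ≤ C ∧ y ∉ C := fun y hy => by
    obtain ⟨C, hSC, hyC, hT⟩ := exists_quotient_isMonolith S hy
    have hV := h.isVModule_quotient hN hS (ne_bot_of_le_ne_bot hS.1 hSC)
    exact ⟨C, isSimpleModule_iff_isCoatom.1
      (hT.isSimpleModule_of_eq_top (hT.eq_top_of_isVModule hV)), hSC, hyC⟩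
  obtain ⟨y, -, hy⟩ := SetLike.exists_of_lt hS'.lt_top
  obtain ⟨C, hC, hSC, -⟩ := hco y hy
  convert hC
  refine le_antisymm hSC fun z hz => ?_
  by_contra hzS
  obtain ⟨D, hD, -, hzD⟩ := hco z hzS
  have hsup : C ⊔ D = ⊤ := hC.2 _ (left_lt_sup.2 fun hDC =>
    hzD ((hD.le_iff.1 hDC).resolve_left hC.1 ▸ hz))
  rcases hS.eq_top_or_eq_top (hinj.of_isSubgenerated hN) (h N hN S hS hS') hsup with h0 | h0
  · exact hC.1 h0
  · exact hD.1 h0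

end Structure

/-! ### `M`-injective hulls of monolithic modules -/

section Hull

theorem exists_injective_linearMap_to_injective (R : Type u) [Ring R] (N : Type max u v)
    [AddCommGroup N] [Module R N] :
    ∃ (Q : Type max u v) (_ : AddCommGroup Q) (_ : Module R Q) (i : N →ₗ[R] Q),
      Function.Injective i ∧ Module.Injective R Q := by
  obtain ⟨⟨J, hJ, f, hf⟩⟩ := (ModuleCat.enoughInjectives.{v, u} R).presentation (ModuleCat.of R N)
  exact ⟨J, inferInstance, inferInstance, f.hom, (ModuleCat.mono_iff_injective f).1 hf,
    Module.injective_module_of_injective_object (inj := hJ) R J⟩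

variable {R : Type u} [Ring R] {M N : Type max u v} [AddCommGroup M] [Module R M]
  [AddCommGroup N] [Module R N] {S : Submodule R N}

/-- A module of `σ(M)` with a monolith embeds in an `M`-injective one. -/
theorem IsMonolith.exists_injective_hull (hS : IsMonolith S) (hN : IsSubgenerated R M N) :
    ∃ (E : Type max u v) (_ : AddCommGroup E) (_ : Module R E) (j : N →ₗ[R] E)
      (T : Submodule R E), Function.Injective j ∧ IsSubgenerated R M E ∧ IsMonolith T ∧
      IsRelInjective R E M := by
  obtain ⟨Q, _, _, i, hi, hQ⟩ := exists_injective_linearMap_to_injective.{u, v} R N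
  obtain ⟨x, hx, hx0⟩ := Submodule.exists_mem_ne_zero_of_ne_bot hS.1
  have hix0 : i x ≠ 0 := fun h0 => hx0 (hi (h0.trans (map_zero i).symm))
  -- `E` is maximal among the submodules of `Q` that lie in `σ(M)` and in which `i x` still
  -- generates the monolith.
  obtain ⟨E, hNE, hE⟩ := zorn_le_nonempty₀
    {E : Submodule R Q | IsSubgenerated R M E ∧ ∀ y ∈ E, y ≠ 0 → i x ∈ Submodule.span R {y}}
    (fun c hc hchain D hD => ⟨sSup c, ⟨.sSup c fun P hP => (hc hP).1, fun y hy hy0 => by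
      obtain ⟨P, hP, hyP⟩ := (Submodule.mem_sSup_of_directed ⟨D, hD⟩ hchain.directedOn).1 hy
      exact (hc hP).2 y hyP hy0⟩, fun z hz => le_sSup hz⟩) (LinearMap.range i)
    ⟨hN.range i, by
      rintro _ ⟨y, rfl⟩ hy0
      obtain ⟨r, hr⟩ := Submodule.mem_span_singleton.1
        (hS.mem_span_singleton hx (y := y) fun h0 => hy0 (by simp [h0]))
      exact Submodule.mem_span_singleton.2 ⟨r, by rw [← map_smul, hr]⟩⟩
  have hixE : i x ∈ E := hNE ⟨x, rfl⟩
  have hT : IsMonolith (Submodule.span R {(⟨i x, hixE⟩ : E)}) := by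
    refine isMonolith_span_singleton (fun h0 => hix0 (congrArg Subtype.val h0)) fun y hy => ?_
    obtain ⟨r, hr⟩ := Submodule.mem_span_singleton.1
      (hE.1.2 y y.2 fun h0 => hy (Subtype.ext h0))
    exact Submodule.mem_span_singleton.2 ⟨r, Subtype.ext hr⟩
  refine ⟨E, inferInstance, inferInstance, i.codRestrict E fun y => hNE ⟨y, rfl⟩, _,
    fun a b hab => hi (congrArg Subtype.val hab), hE.1.1, hT, fun L f => ?_⟩
  obtain ⟨g, hg⟩ := hQ.out L.subtype L.injective_subtype (E.subtype ∘ₗ f)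
  obtain ⟨C, -, hxC, hU⟩ := exists_quotient_isMonolith (⊥ : Submodule R Q) (x := i x) (by simpa)
  have hEC : Function.Injective (C.mkQ ∘ₗ E.subtype) := by
    by_contra hni
    have h1 := hT.le_ker_of_not_injective hni (Submodule.mem_span_singleton_self _)
    exact hxC (by simpa using h1)
  -- The composite `k ∘ C.mkQ` fixes `E`, and `i x` lies in every nonzero submodule of its image.
  -- Applied to `E + g(M)` it gives a competitor containing `E`, so maximality pushes `g` into `E`.
  obtain ⟨k, hk⟩ := hQ.out (C.mkQ ∘ₗ E.subtype) hEC E.subtype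
  have hkE : ∀ y ∈ E, k (C.mkQ y) = y := fun y hy => hk ⟨y, hy⟩
  have hkinj : Function.Injective k := by
    by_contra hni
    have h1 := hU.le_ker_of_not_injective hni (Submodule.mem_span_singleton_self _)
    rw [LinearMap.mem_ker, hkE _ hixE] at h1
    exact hix0 h1
  set W := E ⊔ LinearMap.range g
  set E' := LinearMap.range (k ∘ₗ C.mkQ ∘ₗ W.subtype)
  have hle : E' ≤ E := by
    refine hE.2 (y := E') ⟨(hE.1.1.sup ((IsSubgenerated.refl R M).range g)).range _, ?_⟩ ?_
    · rintro _ ⟨y, rfl⟩ hy0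
      have hy0' : C.mkQ (y : Q) ≠ 0 := fun h0 => hy0 (by
        simp only [LinearMap.comp_apply, Submodule.subtype_apply, h0, map_zero])
      obtain ⟨r, hr⟩ := Submodule.mem_span_singleton.1
        (hU.mem_span_singleton (Submodule.mem_span_singleton_self _) hy0')
      refine Submodule.mem_span_singleton.2 ⟨r, ?_⟩
      simp only [LinearMap.comp_apply, Submodule.subtype_apply]
      rw [← map_smul, hr, hkE _ hixE]
    · exact fun y hy => ⟨⟨y, Submodule.mem_sup_left hy⟩, hkE y hy⟩
  refine ⟨(k ∘ₗ C.mkQ ∘ₗ g).codRestrict E fun m =>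
    hle ⟨⟨g m, Submodule.mem_sup_right ⟨m, rfl⟩⟩, rfl⟩, LinearMap.ext fun y => Subtype.ext ?_⟩
  have : g (y : M) = f y := hg y
  change k (C.mkQ (g (y : M))) = f y
  rw [this, hkE _ (f y).2]

/-- The monolith of the `M`-injective extension is a maximal submodule there, and the nonsimple
image of `N` contains it strictly, hence is everything. -/
theorem MonolithicProjective.isRelInjective (h : MonolithicProjective R M)
    (hN : IsSubgenerated R M N) (hS : IsMonolith S) (hS' : S ≠ ⊤) : IsRelInjective R N M := by
  obtain ⟨E, _, _, j, T, hj, hE, hT, hinj⟩ := hS.exists_injective_hull hN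
  have hT' : T ≠ ⊤ := fun h0 =>
    hS.not_range_le_of_isAtom hS' hj hT.isAtom (h0 ▸ le_top)
  have hco := h.isCoatom_of_isRelInjective hE hT hT' hinj
  have hle : T ≤ LinearMap.range j := by
    refine hT.2 _ fun h0 => hS.not_range_le_of_isAtom hS' hj hT.isAtom (h0 ▸ bot_le)
  have htop : LinearMap.range j = ⊤ := (hco.le_iff.1 hle).resolve_right fun h0 =>
    hS.not_range_le_of_isAtom hS' hj hT.isAtom h0.le
  exact hinj.of_equiv (LinearEquiv.ofBijective j ⟨hj, LinearMap.range_eq_top.1 htop⟩).symm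

theorem MonolithicProjective.isCoatom (h : MonolithicProjective R M)
    (hN : IsSubgenerated R M N) (hS : IsMonolith S) (hS' : S ≠ ⊤) : IsCoatom S :=
  h.isCoatom_of_isRelInjective hN hS hS' (h.isRelInjective hN hS hS')

end Hull

/-! ### Independent families and their monoliths -/

section Family

theorem sSupIndep.insert_of_disjoint {α : Type*} [CompleteLattice α] [IsModularLattice α]
    {s : Set α} (hs : sSupIndep s) {b : α} (hb : Disjoint b (sSup s)) :
    sSupIndep (insert b s) := by
  rintro a (rfl | ha)
  · refine hb.mono_right (sSup_le_sSup ?_)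
    rintro c ⟨rfl | hc, hne⟩
    · exact absurd rfl hne
    · exact hc
  · have h1 : Disjoint a (sSup (s \ {a}) ⊔ b) :=
      Disjoint.disjoint_sup_right_of_disjoint_sup_left (hs ha)
        (hb.symm.mono_left (sup_le (le_sSup ha) (sSup_le_sSup Set.sdiff_subset)))
    refine h1.mono_right (sSup_le ?_)
    rintro c ⟨rfl | hc, hne⟩
    · exact le_sup_right
    · exact le_sup_of_le_left (le_sSup ⟨hc, hne⟩)

/-- If `r` moves a nonzero coordinate of `t` to a nonzero element of `S i`, then `r • t ≠ 0`, and a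
scalar bringing `r • t` back to `t` brings that element back to the coordinate. -/
theorem iSupIndep.mem_iSup_of_isMonolith {R : Type*} [Ring R] {N : Type*} [AddCommGroup N]
    [Module R N] {ι : Type*} {A : ι → Submodule R N} (hA : iSupIndep A)
    {S : ∀ i, Submodule R (A i)} (hS : ∀ i, IsMonolith (S i)) {t : N}
    (ht : ∀ r : R, r • t ≠ 0 → t ∈ Submodule.span R {r • t}) (htA : t ∈ ⨆ i, A i) :
    t ∈ ⨆ i, (S i).map (A i).subtype := by
  classical
  rw [Submodule.mem_iSup_iff_exists_dfinsupp] at htA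
  obtain ⟨y, hy⟩ := htA
  have hinj := hA.dfinsupp_lsum_injective
  have hsmul : ∀ r : R, DFinsupp.lsum ℕ (fun i => (A i).subtype) (r • y) = r • t := fun r => by
    rw [map_smul, ← hy]
  have hmem : ∀ i, y i ∈ S i := fun i => by
    by_cases hyi : y i = 0
    · simp [hyi]
    obtain ⟨m, hm, hm0⟩ := Submodule.exists_mem_ne_zero_of_ne_bot (hS i).1
    obtain ⟨r, rfl⟩ := Submodule.mem_span_singleton.1 ((hS i).mem_span_singleton hm hyi)
    have hrt : r • t ≠ 0 := fun h0 => hm0 (by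
      have : r • y = 0 := hinj (by rw [hsmul, h0, map_zero])
      rw [← DFinsupp.smul_apply, this, DFinsupp.zero_apply])
    obtain ⟨q, hq⟩ := Submodule.mem_span_singleton.1 (ht r hrt)
    have : (q * r) • y = y := hinj (by rw [hsmul, mul_smul, hq, ← hy])
    rw [← this, DFinsupp.smul_apply, mul_smul]
    exact (S i).smul_mem q hm
  rw [← hy, DFinsupp.lsum_apply_apply]
  refine Submodule.dfinsuppSumAddHom_mem _ _ _ fun i _ => ?_
  exact Submodule.mem_iSup_of_mem i ⟨y i, hmem i, rfl⟩

end Family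

/-! ### Condition 3 and the equivalence -/

section Characterization

theorem MonolithicProjective.exists_family {R : Type u} [Ring R] {M : Type max u v}
    [AddCommGroup M] [Module R M] (h : MonolithicProjective R M) :
    ∃ (I : Type max u v) (A : I → Submodule R M),
      iSupIndep A ∧
      (∀ i, IsLocalMod R (A i)) ∧
      (∀ i, IsRelInjective R (A i) M ∧ IsRelProjective R (A i) M ∧ Module.length R (A i) = 2) ∧
      (iSupIndep (fun i => jacobsonOfSubmodule R M (A i)) ∧
        Module.jacobson R M = ⨆ i, jacobsonOfSubmodule R M (A i)) ∧
      IsVModule R (M ⧸ Module.jacobson R M) := by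
  -- A maximal independent set of nonsimple monolithic submodules; each has length two, with its
  -- monolith as radical.
  obtain ⟨s, hs⟩ := zorn_subset {s : Set (Submodule R M) | sSupIndep s ∧
      ∀ A ∈ s, ∃ S : Submodule R A, IsMonolith S ∧ S ≠ ⊤}
    fun c hc hchain => ⟨⋃₀ c, ⟨iSupIndep_sUnion_of_directed hchain.directedOn
        fun t ht => (hc ht).1, fun A ⟨t, ht, hA⟩ => (hc ht).2 A hA⟩,
      fun _ => Set.subset_sUnion_of_mem⟩
  have hM := IsSubgenerated.refl R M
  have hsub : ∀ A : Submodule R M, IsSubgenerated R M A := fun A =>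
    hM.of_injective A.subtype A.injective_subtype
  choose S hS hS' using fun A : s => hs.1.2 A A.2
  have hco : ∀ A : s, IsCoatom (S A) := fun A => h.isCoatom (hsub A) (hS A) (hS' A)
  have hJ : ∀ A : s, jacobsonOfSubmodule R M A = (S A).map (A : Submodule R M).subtype :=
    fun A => by rw [jacobsonOfSubmodule, (hS A).jacobson_eq (hco A)]
  have hind : iSupIndep (fun A : s => (A : Submodule R M)) := (sSupIndep_iff s).1 hs.1.1
  refine ⟨s, fun A => A, hind, fun A => (hS A).isLocalMod (hco A), fun A =>
    ⟨h.isRelInjective (hsub A) (hS A) (hS' A),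
      (h A (hsub A) (S A) (hS A) (hS' A)).isRelProjective, (hS A).length_eq_two (hco A)⟩,
    ⟨hind.mono fun A => Submodule.map_subtype_le _ _, le_antisymm (fun x hx => ?_) ?_⟩, ?_⟩
  · by_contra hxJ
    obtain ⟨C, hJC, hxC, hT⟩ := exists_quotient_isMonolith _ hxJ
    -- A simple quotient `M ⧸ C` would make `C` maximal, but `x` lies in the radical and not in `C`.
    have hT' : Submodule.span R {C.mkQ x} ≠ ⊤ := fun h0 => hxC (by
      have hC : IsCoatom C := isSimpleModule_iff_isCoatom.1 (hT.isSimpleModule_of_eq_top h0)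
      exact (sInf_le hC : Module.jacobson R M ≤ C) hx)
    obtain ⟨σ, hσ⟩ := h.exists_section hM C.mkQ C.mkQ_surjective hT hT'
    have hσ' : ∀ y, C.mkQ (σ y) = y := fun y => LinearMap.congr_fun hσ y
    have hσinj : Function.Injective σ := Function.LeftInverse.injective hσ'
    have ht0 : σ (C.mkQ x) ≠ 0 := fun h0 => hxC (by
      have := hσ' (C.mkQ x)
      rw [h0, map_zero] at this
      simpa using this.symm)
    have htC : σ (C.mkQ x) ∉ C := fun h0 => hxC (by
      have h1 : C.mkQ (σ (C.mkQ x)) = 0 := by simpa using h0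
      rw [hσ'] at h1
      simpa using h1)
    have hspan : ∀ y : M, y ∈ LinearMap.range σ → y ≠ 0 →
        σ (C.mkQ x) ∈ Submodule.span R {y} := by
      rintro _ ⟨y, rfl⟩ hy
      obtain ⟨r, hr⟩ := Submodule.mem_span_singleton.1 (hT.mem_span_singleton
        (Submodule.mem_span_singleton_self _) (y := y) fun h0 => hy (by simp [h0]))
      exact Submodule.mem_span_singleton.2 ⟨r, by rw [← map_smul, hr]⟩
    -- If they met, the generator of the monolith of `range σ` would lie in the sum of the monoliths
    -- of the family, hence in `C`. So `range σ` can be adjoined, against maximality.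
    have hdis : Disjoint (LinearMap.range σ) (sSup s) := by
      rw [Submodule.disjoint_def]
      intro y hy hys
      by_contra hy0
      have hts : σ (C.mkQ x) ∈ ⨆ A : s, (A : Submodule R M) := by
        rw [← sSup_eq_iSup']
        exact (Submodule.span_singleton_le_iff_mem _ _).2 hys (hspan y hy hy0)
      have hmem := hind.mem_iSup_of_isMonolith hS
        (fun r hr => hspan _ (Submodule.smul_mem _ r ⟨_, rfl⟩) hr) hts
      simp only [← hJ] at hmem
      exact htC (hJC hmem)
    have hins : insert (LinearMap.range σ) s ⊆ s := hs.2
      (y := insert (LinearMap.range σ) s) ⟨hs.1.1.insert_of_disjoint hdis, by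
        rintro A (rfl | hA)
        · refine ⟨_, hT.map_equiv (LinearEquiv.ofInjective σ hσinj), fun h0 => hT' ?_⟩
          exact Submodule.map_injective_of_injective
            (f := (LinearEquiv.ofInjective σ hσinj).toLinearMap) (LinearEquiv.injective _)
            (h0.trans (LinearEquiv.range _).symm |>.trans (LinearMap.range_eq_map _))
        · exact hs.1.2 A hA⟩ (Set.subset_insert _ _)
    have hle : LinearMap.range σ ≤ sSup s := le_sSup (hins (Set.mem_insert _ _))
    exact ht0 (Submodule.disjoint_def.1 hdis _ ⟨_, rfl⟩ (hle ⟨_, rfl⟩))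
  · exact iSup_le fun A => Module.map_jacobson_le _
  · by_contra hV
    obtain ⟨C, T, hT, hT'⟩ := exists_quotient_of_not_isVModule hV
    set p := C.mkQ ∘ₗ (Module.jacobson R M).mkQ
    have hp : Function.Surjective p := by
      rw [LinearMap.coe_comp]
      exact C.mkQ_surjective.comp (Submodule.mkQ_surjective _)
    obtain ⟨σ, hσ⟩ := h.exists_section hM p hp hT hT'
    have hTJ := hT.jacobson_eq (h.isCoatom (hM.of_surjective p hp) hT hT')
    refine hT.1 ((Submodule.eq_bot_iff T).2 fun y hy => ?_)
    -- The section carries the radical `T` into `J(M)`, which `p` kills.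
    have h1 : σ y ∈ Module.jacobson R M := Module.map_jacobson_le σ ⟨y, hTJ ▸ hy, rfl⟩
    have h2 : (Module.jacobson R M).mkQ (σ y) = 0 := by simpa using h1
    have h3 : p (σ y) = y := LinearMap.congr_fun hσ y
    rw [← h3, LinearMap.comp_apply, h2, map_zero]

variable {R : Type u} [Ring R] {M : Type w} [AddCommGroup M] [Module R M]

theorem monolithicProjective_of_family {I : Type*} (A : I → Submodule R M)
    (hloc : ∀ i, IsLocalMod R (A i))
    (hA : ∀ i, IsRelInjective R (A i) M ∧ IsRelProjective R (A i) M ∧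
      Module.length R (A i) = 2)
    (hJ : Module.jacobson R M = ⨆ i, jacobsonOfSubmodule R M (A i))
    (hV : IsVModule R (M ⧸ Module.jacobson R M)) : MonolithicProjective R M := by
  rintro N _ _ ⟨Λ, K, j, hj⟩ S hS hS'
  obtain ⟨x, hx, hx0⟩ := Submodule.exists_mem_ne_zero_of_ne_bot hS.1
  obtain ⟨C, -, hxC, hT⟩ := exists_quotient_isMonolith (⊥ : Submodule R ((Λ →₀ M) ⧸ K))
    (x := j x) (fun h0 => hx0 (hj (h0.trans (map_zero j).symm)))
  have hq : Function.Injective (C.mkQ ∘ₗ j) := by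
    by_contra hni
    exact hxC (by simpa using hS.le_ker_of_not_injective hni hx)
  set p := C.mkQ ∘ₗ K.mkQ
  have hp : Function.Surjective p := by
    rw [LinearMap.coe_comp]
    exact C.mkQ_surjective.comp K.mkQ_surjective
  have hQ : IsSubgenerated R M (((Λ →₀ M) ⧸ K) ⧸ C) :=
    .of_surjective_of_injective p hp LinearMap.id Function.injective_id
  choose L hLatom hLco hLmax using fun i => (hloc i).exists_isAtom_isCoatom (hA i).2.2
  -- An embedded `A i` is a retract of the monolithic quotient; the retraction is then injective, so
  -- the nonsimple `N` embeds in `A i` and fills it.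
  by_cases hex : ∃ l i, Function.Injective (p ∘ₗ Finsupp.lsingle l ∘ₗ (A i).subtype)
  · obtain ⟨l, i, ha⟩ := hex
    set a := p ∘ₗ Finsupp.lsingle l ∘ₗ (A i).subtype
    obtain ⟨r, hr⟩ := ((hA i).1.of_isSubgenerated hQ).exists_comp_eq a ha LinearMap.id
    have hra : ∀ y, r (a y) = y := fun y => LinearMap.congr_fun hr y
    have hdis : Disjoint (LinearMap.ker r) (LinearMap.range a) := by
      rw [Submodule.disjoint_def]
      rintro _ h1 ⟨y, rfl⟩
      rw [LinearMap.mem_ker, hra] at h1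
      simp [h1]
    have hrinj : Function.Injective r := by
      refine LinearMap.ker_eq_bot.1 ((hT.eq_bot_or_eq_bot hdis).resolve_right fun h0 => ?_)
      refine (hLatom i).1 ((Submodule.eq_bot_iff _).2 fun y _ => ?_)
      rw [← hra y, LinearMap.range_eq_bot.1 h0]
      simp
    have hb : Function.Injective (r ∘ₗ C.mkQ ∘ₗ j) := by
      rw [LinearMap.coe_comp]
      exact hrinj.comp hq
    have hsurj : Function.Surjective (r ∘ₗ C.mkQ ∘ₗ j) := by
      rw [← LinearMap.range_eq_top]
      by_contra hne
      exact hS.not_range_le_of_isAtom hS' hb (hLatom i) (hLmax i _ hne)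
    have : IsNoetherian R (A i) := (isFiniteLength_iff_isNoetherian_isArtinian.1
      (Module.length_ne_top_iff.1 (by rw [(hA i).2.2]; exact ENat.ofNat_ne_top 2))).1
    exact (IsProjectiveInSigma.of_isRelProjective
      ((IsSubgenerated.refl R M).of_injective _ (A i).injective_subtype) (hA i).2.1).of_equiv
      (LinearEquiv.ofBijective _ ⟨hb, hsurj⟩).symm
  -- Every map from `A i` now kills its simple radical, so each coordinate copy of `M` acts through
  -- `M/J(M)` and the quotient is a `V`-module.
  · push Not at hex
    have hQV : IsVModule R (((Λ →₀ M) ⧸ K) ⧸ C) := fun U _ _ hU => by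
      refine isRelInjective_of_sSup_eq_top
        (Set.range fun l : Λ => LinearMap.range (p ∘ₗ Finsupp.lsingle l)) ?_ ?_
      · rw [sSup_range]
        simp only [LinearMap.range_comp]
        rw [← Submodule.map_iSup, Finsupp.iSup_lsingle_range, Submodule.map_top,
          LinearMap.range_eq_top.2 hp]
      · rintro _ ⟨l, rfl⟩
        have hker : LinearMap.ker (Module.jacobson R M).mkQ ≤
            LinearMap.ker (p ∘ₗ Finsupp.lsingle l).rangeRestrict := by
          rw [Submodule.ker_mkQ, LinearMap.ker_rangeRestrict, hJ]
          refine iSup_le fun i => Submodule.map_le_iff_le_comap.2 ?_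
          refine (sInf_le (hLco i) : Module.jacobson R (A i) ≤ L i).trans ?_
          have hne : LinearMap.ker (p ∘ₗ Finsupp.lsingle l ∘ₗ (A i).subtype) ≠ ⊥ := fun h0 =>
            hex l i (LinearMap.ker_eq_bot.1 h0)
          change L i ≤ LinearMap.ker (p ∘ₗ Finsupp.lsingle l ∘ₗ (A i).subtype)
          by_cases htop : LinearMap.ker (p ∘ₗ Finsupp.lsingle l ∘ₗ (A i).subtype) = ⊤
          · rw [htop]
            exact le_top
          · exact (((hLatom i).le_iff.1 (hLmax i _ htop)).resolve_left hne).ge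
        obtain ⟨r, hr⟩ := LinearMap.exists_comp_eq_of_ker_le _ (Submodule.mkQ_surjective _) _ hker
        refine (hV U hU).of_surjective r fun y => ?_
        obtain ⟨m, rfl⟩ := LinearMap.surjective_rangeRestrict _ y
        exact ⟨_, hr m⟩
    exact absurd ((hT.eq_top_of_isVModule hQV).symm ▸ le_top)
      (hS.not_range_le_of_isAtom hS' hq hT.isAtom)

end Characterization

theorem theorem2p1 (R : Type u) [Ring R] (M : Type (max u v)) [AddCommGroup M] [Module R M] :
    List.TFAE [
      IsAlmostVModule R M,
      ∀ (N : Type (max u v)) [AddCommGroup N] [Module R N], IsSubgenerated R M N →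
        IsVModule R N ∨
        ∃ D C : Submodule R N, IsCompl D C ∧ D ≠ ⊥ ∧ IsProjectiveInSigma R M D,
      ∃ (I : Type (max u v)) (A : I → Submodule R M),
        iSupIndep A ∧
        (∀ i, IsLocalMod R (A i)) ∧
        (∀ i, IsRelInjective R (A i) M ∧ IsRelProjective R (A i) M ∧ Module.length R (A i) = 2) ∧
        (iSupIndep (fun i => jacobsonOfSubmodule R M (A i)) ∧
          Module.jacobson R M = ⨆ i, jacobsonOfSubmodule R M (A i)) ∧
        IsVModule R (M ⧸ Module.jacobson R M)] := by
  tfae_have 1 → 2 := fun h N _ _ hN =>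
    or_iff_not_imp_left.2 (h.monolithicProjective.exists_projective_summand hN)
  tfae_have 2 → 3 := fun h =>
    (monolithicProjective_of_exists_projective_summand h).exists_family
  tfae_have 3 → 1 := fun ⟨_, A, _, hloc, hA, ⟨_, hJ⟩, hV⟩ =>
    (monolithicProjective_of_family A hloc hA hJ hV).isAlmostVModule
  tfae_finish
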